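/- Let $\Lambda$ be the set of terms of the untyped $\lambda$-calculus over a countably infinite set of variables. For a set $G$ let $G^*$ be the set of its finite subsets and $\mathcal P(G)$ its powerset. A \emph{graph model} is a pair $\mathcal G=(G,c_{\mathcal G})$ consisting of an infinite set $G$ and an injective total function $c_{\mathcal G}:G^*\times G\to G$. The interpretation $M^{\mathcal G}_\rho\subseteq G$ of $M\in\Lambda$ in an environment $\rho$, a map from the variables to $\mathcal P(G)$, is defined by $$x^{\mathcal G}_\rho=\rho(x),\qquad (MN)^{\mathcal G}_\rho=\{\alpha\in G : (\exists a\in G^*)\; a\subseteq N^{\mathcal G}_\rho \text{ and } c_{\mathcal G}(a,\alpha)\in M^{\mathcal G}_\rho\},$$ $$(\lambda x.M)^{\mathcal G}_\rho=\{c_{\mathcal G}(a,\alpha) : a\in G^*,\ \alpha\in M^{\mathcal G}_{\rho[x:=a]}\}.$$ The \emph{order theory} of $\mathcal G$ is $$\mathrm{Ord}(\mathcal G)=\{(M,N)\in\Lambda\times\Lambda : M^{\mathcal G}_\rho\subseteq N^{\mathcal G}_\rho\text{ for all environments }\rho\}.$$ Then, for every graph model $\mathcal G$, the order theory $\mathrm{Ord}(\mathcal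 G)$ is not recursively enumerable, that is, the set of Gödel numbers of the pairs in $\mathrm{Ord}(\mathcal G)$ is not a recursively enumerable set of natural numbers. -/

import Mathlib

universe u

namespace LambdaGraph

/-- Untyped lambda terms with named variables; the variables are the natural numbers.
`lam x M` is the abstraction of the variable `x` in `M`. -/
inductive Term : Type
  | var (x : ℕ) : Term
  | app (M N : Term) : Term
  | lam (x : ℕ) (M : Term) : Term

/-- The standard Goedel numbering of lambda terms. -/
def Term.code : Term → ℕ
  | .var x => 3 * x
  | .app M N => 3 * Nat.pair M.code N.code + 1
  | .lam x M => 3 * Nat.pair x M.code + 2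

/-- The Goedel numbering is a bijection from the lambda terms onto the natural numbers. -/
theorem Term.code_bijective : Function.Bijective Term.code := by
  constructor
  · intro M
    induction M with
    | var x =>
      intro N h
      cases N <;> simp only [Term.code] at h <;> first | omega | (congr 1; omega)
    | app P Q ihP ihQ =>
      intro N h
      rcases N with y | ⟨A, B⟩ | ⟨y, A⟩ <;> simp only [Term.code] at h
      · omega
      · obtain ⟨h1, h2⟩ := Nat.pair_eq_pair.1 (show Nat.pair P.code Q.code = Nat.pair A.code B.code by omega)
        rw [ihP h1, ihQ h2]
      · omega
    | lam x P ih =>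
      intro N h
      rcases N with y | ⟨A, B⟩ | ⟨y, A⟩ <;> simp only [Term.code] at h
      · omega
      · omega
      · obtain ⟨h1, h2⟩ := Nat.pair_eq_pair.1 (show Nat.pair x P.code = Nat.pair y A.code by omega)
        rw [h1, ih h2]
  · intro n
    induction n using Nat.strong_induction_on with
    | _ n ih =>
      have hl := Nat.unpair_left_le (n / 3)
      have hr := Nat.unpair_right_le (n / 3)
      have hp := Nat.pair_unpair (n / 3)
      obtain h | h | h : n % 3 = 0 ∨ n % 3 = 1 ∨ n % 3 = 2 := by omega
      · exact ⟨.var (n / 3), by simp only [Term.code]; omega⟩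
      · obtain ⟨M, hM⟩ := ih (n / 3).unpair.1 (by omega)
        obtain ⟨N, hN⟩ := ih (n / 3).unpair.2 (by omega)
        exact ⟨.app M N, by simp only [Term.code, hM, hN, hp]; omega⟩
      · obtain ⟨M, hM⟩ := ih (n / 3).unpair.2 (by omega)
        exact ⟨.lam (n / 3).unpair.1 M, by simp only [Term.code, hM, hp]; omega⟩

/-- A graph model: an infinite carrier set `G` with a total injective function
`c : G* × G → G`, where `G*` is the set of finite subsets of `G`. -/
structure GraphModel where
  /-- The carrier set. -/
  carrier : Type u
  infinite : Infinite carrier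
  /-- The coding of pairs (finite subset, element). -/
  c : Finset carrier × carrier → carrier
  injective : Function.Injective c

namespace GraphModel

variable (G : GraphModel.{u})

/-- Application in the reflexive cpo of subsets of the carrier set. -/
def apply (X Y : Set G.carrier) : Set G.carrier :=
  {α | ∃ a : Finset G.carrier, (a : Set G.carrier) ⊆ Y ∧ G.c (a, α) ∈ X}

/-- The set of codes of the (finitary part of the) graph of `f`. -/
def abstr (f : Set G.carrier → Set G.carrier) : Set G.carrier :=
  {β | ∃ (a : Finset G.carrier) (α : G.carrier), α ∈ f a ∧ β = G.c (a, α)}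

/-- The interpretation of a lambda term in the environment `ρ`. -/
def interp : Term → (ℕ → Set G.carrier) → Set G.carrier
  | .var x, ρ => ρ x
  | .app M N, ρ => G.apply (interp M ρ) (interp N ρ)
  | .lam x M, ρ => G.abstr fun d => interp M (Function.update ρ x d)

/-- The order theory of a graph model: the set of pairs `(M, N)` of lambda terms such that
the interpretation of `M` is below that of `N` in every environment. -/
def Ord : Set (Term × Term) :=
  {p | ∀ ρ : ℕ → Set G.carrier, G.interp p.1 ρ ⊆ G.interp p.2 ρ}

end GraphModel

/-- A set of pairs of lambda terms is recursively enumerable if the set of Goedel numbers of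
its members is a recursively enumerable set of natural numbers. -/
def IsRE (T : Set (Term × Term)) : Prop :=
  REPred fun n : ℕ => ∃ p ∈ T, n = Nat.pair p.1.code p.2.code

end LambdaGraph

/-!
Write `I = λx.x` and `K = λxy.x`. Suppose that the order theory of `G` is recursively enumerable.
Then so is the set of terms `M` with `M ≤ I` in `G`. The set of terms `M` with `M ≰ I` in *some*
graph model is recursively enumerable in any case, and the two sets cover all terms. They are
closed under equality in all graph models, `K` is not in the first and `I` is not in the second, so
the recursion-theoretic argument behind Scott's theorem applies: the cover shrinks to a recursive
partition (`exists_partrec_of_cover`), which is computed by a lambda term, and a self-referential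
term `F` can be built which equals `K` if its own code is put into the first set and `I` if it is
put into the second (`exists_diagonal`). Either case is absurd; that `K ≤ I` fails in `G` is the
injectivity of the coding function (`GraphModel.not_interp_constT_subset`).

That `M ≰ I` in some graph model is recursively enumerable holds because it is a finitary fact.
An element of the interpretation of `M` is there because of finitely many values of the coding
function (`GraphModel.exists_finset_mem_interpOn`). These values, renamed by natural numbers, and a
derivation which uses only them form a finite object that can be checked
primitive recursively (`Certificate`, `GraphModel.exists_certificate`). Conversely a finite
injective part of a coding function on the natural numbers extends to a graph model, and it can be
extended so that the element stays outside the interpretation of `I`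
(`Certificate.exists_not_subset`); `I` is suitable since membership in its interpretation is decided
by a single preimage under the coding function.

No syntactic theory of reduction is needed. Graph models validate the law `β` in the form
`GraphModel.apply_interp_lam`, and the representation of partial recursive functions
(`GraphModel.apply_codeT`) is proved as a statement about all graph models, with Scott numerals,
streams in the place of lists, and Mathlib's `Turing.ToPartrec.Code` as the model of computation.
-/

universe v

/-! ### Finite approximation and the law `β` -/

namespace LambdaGraph
namespace GraphModel

variable (G : GraphModel.{u})

theorem apply_mono {X X' Y Y' : Set G.carrier} (hX : X ⊆ X') (hY : Y ⊆ Y') :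
    G.apply X Y ⊆ G.apply X' Y' :=
  fun _ ⟨a, ha, hc⟩ => ⟨a, ha.trans hY, hX hc⟩

theorem interp_mono (M : Term) {ρ σ : ℕ → Set G.carrier} (h : ∀ x, ρ x ⊆ σ x) :
    G.interp M ρ ⊆ G.interp M σ := by
  induction M generalizing ρ σ with
  | var x => exact h x
  | app M N ihM ihN => exact G.apply_mono (ihM h) (ihN h)
  | lam x M ih =>
    rintro _ ⟨a, α, hα, rfl⟩
    refine ⟨a, α, ih (fun y => ?_) hα, rfl⟩
    by_cases hy : y = x
    · subst hy; simp
    · simpa [hy] using h y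

/-- The interpretation of a term in the partial model obtained by restricting the coding
function to a set `S`: every element that occurs in the computation has to lie in `S`. -/
def interpOn (S : Set G.carrier) : Term → (ℕ → Set G.carrier) → Set G.carrier
  | .var x, ρ => ρ x ∩ S
  | .app M N, ρ => {α | α ∈ S ∧ ∃ a : Finset G.carrier,
      (a : Set G.carrier) ⊆ interpOn S N ρ ∧ G.c (a, α) ∈ interpOn S M ρ}
  | .lam x M, ρ => {β | β ∈ S ∧ ∃ (a : Finset G.carrier) (α : G.carrier),
      (a : Set G.carrier) ⊆ S ∧ α ∈ interpOn S M (Function.update ρ x a) ∧ β = G.c (a, α)}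

theorem interpOn_subset (S : Set G.carrier) (M : Term) (ρ : ℕ → Set G.carrier) :
    G.interpOn S M ρ ⊆ S := by
  cases M with
  | var x => exact Set.inter_subset_right
  | app M N => exact fun _ h => h.1
  | lam x M => exact fun _ h => h.1

theorem interpOn_mono {S T : Set G.carrier} (h : S ⊆ T) (M : Term) (ρ : ℕ → Set G.carrier) :
    G.interpOn S M ρ ⊆ G.interpOn T M ρ := by
  induction M generalizing ρ with
  | var x => exact Set.inter_subset_inter_right _ h
  | app M N ihM ihN =>
    rintro α ⟨hα, a, ha, hc⟩
    exact ⟨h hα, a, ha.trans (ihN ρ), ihM ρ hc⟩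
  | lam x M ih =>
    rintro β ⟨hβ, a, α, ha, hα, rfl⟩
    exact ⟨h hβ, a, α, ha.trans h, ih _ hα, rfl⟩

theorem interpOn_subset_interp (S : Set G.carrier) (M : Term) (ρ : ℕ → Set G.carrier) :
    G.interpOn S M ρ ⊆ G.interp M fun x => ρ x ∩ S := by
  induction M generalizing ρ with
  | var x => exact subset_rfl
  | app M N ihM ihN =>
    rintro α ⟨-, a, ha, hc⟩
    exact ⟨a, ha.trans (ihN ρ), ihM ρ hc⟩
  | lam x M ih =>
    rintro β ⟨-, a, α, -, hα, rfl⟩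
    refine ⟨a, α, G.interp_mono M (fun y => ?_) (ih _ hα), rfl⟩
    by_cases hy : y = x
    · subst hy; simp
    · simp [hy]

/-- Membership in an interpretation is a finitary fact about the coding function. -/
theorem exists_finset_mem_interpOn {M : Term} {ρ : ℕ → Set G.carrier} {α : G.carrier}
    (h : α ∈ G.interp M ρ) : ∃ S : Finset G.carrier, α ∈ G.interpOn S M ρ := by
  classical
  induction M generalizing ρ α with
  | var x => exact ⟨{α}, h, by simp⟩
  | app M N ihM ihN =>
    obtain ⟨a, ha, hc⟩ := h
    obtain ⟨S, hS⟩ := ihM hc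
    choose! T hT using fun γ (hγ : γ ∈ a) => ihN (ha hγ)
    refine ⟨insert α (S ∪ a.biUnion T), by simp, a, fun γ hγ => ?_, ?_⟩
    · refine G.interpOn_mono ?_ _ _ (hT γ hγ)
      exact Finset.coe_subset.2 (((Finset.subset_biUnion_of_mem T hγ).trans
        Finset.subset_union_right).trans (Finset.subset_insert _ _))
    · refine G.interpOn_mono ?_ _ _ hS
      exact Finset.coe_subset.2 (Finset.subset_union_left.trans (Finset.subset_insert _ _))
  | lam x M ih =>
    obtain ⟨a, α, hα, rfl⟩ := h
    obtain ⟨S, hS⟩ := ih hα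
    refine ⟨insert (G.c (a, α)) (S ∪ a), by simp, a, α, ?_, ?_, rfl⟩
    · exact Finset.coe_subset.2 (Finset.subset_union_right.trans (Finset.subset_insert _ _))
    · refine G.interpOn_mono ?_ _ _ hS
      exact Finset.coe_subset.2 (Finset.subset_union_left.trans (Finset.subset_insert _ _))

/-- The law `β`, with the argument given by its value: abstraction followed by application loses
nothing, because interpretations are Scott continuous in the environment. -/
theorem apply_interp_lam (x : ℕ) (M : Term) (ρ : ℕ → Set G.carrier) (Y : Set G.carrier) :
    G.apply (G.interp (.lam x M) ρ) Y = G.interp M (Function.update ρ x Y) := by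
  classical
  ext α
  constructor
  · rintro ⟨a, ha, b, β, hβ, hc⟩
    obtain ⟨rfl, rfl⟩ := Prod.mk.inj (G.injective hc)
    refine G.interp_mono M (fun y => ?_) hβ
    by_cases hy : y = x
    · subst hy; simpa using ha
    · simp [hy]
  · intro h
    obtain ⟨S, hS⟩ := G.exists_finset_mem_interpOn h
    refine ⟨S.filter (· ∈ Y), fun γ hγ => (Finset.mem_filter.1 hγ).2, _, α, ?_, rfl⟩
    refine G.interp_mono M (fun y => ?_) (G.interpOn_subset_interp _ M _ hS)
    by_cases hy : y = x
    · subst hy; intro γ; simp; tauto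
    · simp [hy]

end GraphModel
end LambdaGraph

/-! ### Finite certificates -/

namespace LambdaGraph

/-- An equation `c (a, α) = β` between natural numbers, written as the triple `(a, α, β)`; the
finite set `a` is given by a list of its elements. -/
abbrev Equation := List ℕ × ℕ × ℕ

/-- A judgment `Γ ⊢ M : α`, written as the triple `(Γ, M.code, α)`. The list `Γ` is a finite
environment: `(x, γ) ∈ Γ` says that `γ` belongs to the value of the variable `x`. -/
abbrev Judgment := List (ℕ × ℕ) × ℕ × ℕ

/-- The finitely many equations in `A` are the graph of a well defined and injective partial
function on pairs of a finite set and a number. -/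
def PartialInjection (A : List Equation) : Prop :=
  ∀ e ∈ A, ∀ e' ∈ A, e.2.2 = e'.2.2 ↔ e.1.toFinset = e'.1.toFinset ∧ e.2.1 = e'.2.1

/-- The judgment `j` follows from judgments in `L` and equations in `A` by one of the clauses that
define the interpretation of terms. The three cases are those of a variable, an application and an
abstraction, recognized by the residue modulo 3 of the code. In the last case the
environment `k.1` of the premise is only required to be below the update of `j.1`, so that
no operation on environments is needed. -/
def Justified (A : List Equation) (L : List Judgment) (j : Judgment) : Prop :=
  (j.2.1 % 3 = 0 ∧ (j.2.1 / 3, j.2.2) ∈ j.1) ∨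
  (j.2.1 % 3 = 1 ∧ ∃ e ∈ A, e.2.1 = j.2.2 ∧ (j.1, (j.2.1 / 3).unpair.1, e.2.2) ∈ L ∧
    ∀ γ ∈ e.1, (j.1, (j.2.1 / 3).unpair.2, γ) ∈ L) ∨
  (j.2.1 % 3 = 2 ∧ ∃ e ∈ A, e.2.2 = j.2.2 ∧ ∃ k ∈ L,
    k.2.1 = (j.2.1 / 3).unpair.2 ∧ k.2.2 = e.2.1 ∧
    ∀ b ∈ k.1, (b.1 = (j.2.1 / 3).unpair.1 ∧ b.2 ∈ e.1) ∨ (b.1 ≠ (j.2.1 / 3).unpair.1 ∧ b ∈ j.1))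

/-- A certificate that some graph model does not interpret the term with code `n` below
`λx.x`: a finite part `w.1` of a coding function, a set `w.2.1` of judgments over it that is closed
under justification, and a judgment `w.2.2` from this set which assigns to the term an
element outside the interpretation of `λx.x`. Justification passes to smaller codes, so that
closed sets of judgments are automatically well founded. -/
def Certificate (n : ℕ) (w : List Equation × List Judgment × Judgment) : Prop :=
  PartialInjection w.1 ∧ (∀ j ∈ w.2.1, Justified w.1 w.2.1 j) ∧ w.2.2 ∈ w.2.1 ∧ w.2.2.2.1 = n ∧
    ∀ e ∈ w.1, e.2.2 = w.2.2.2.2 → e.2.1 ∉ e.1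

/-- The identity `λx.x`. -/
def idT : Term := .lam 0 (.var 0)

theorem Term.code_app (M N : Term) : (Term.app M N).code % 3 = 1 ∧
    ((Term.app M N).code / 3).unpair = (M.code, N.code) := by
  have h : (Term.app M N).code / 3 = Nat.pair M.code N.code := by simp only [Term.code]; omega
  exact ⟨by simp only [Term.code]; omega, by rw [h, Nat.unpair_pair]⟩

theorem Term.code_lam (x : ℕ) (M : Term) : (Term.lam x M).code % 3 = 2 ∧
    ((Term.lam x M).code / 3).unpair = (x, M.code) := by
  have h : (Term.lam x M).code / 3 = Nat.pair x M.code := by simp only [Term.code]; omega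
  exact ⟨by simp only [Term.code]; omega, by rw [h, Nat.unpair_pair]⟩

namespace GraphModel

/-- A closed set of judgments holds in every graph model on `ℕ` that extends the given
equations. -/
theorem mem_interp_of_justified (c : Finset ℕ × ℕ → ℕ) (hc : Function.Injective c)
    {A : List Equation} (hA : ∀ e ∈ A, c (e.1.toFinset, e.2.1) = e.2.2)
    {L : List Judgment} (hL : ∀ j ∈ L, Justified A L j) (M : Term) (Γ : List (ℕ × ℕ)) (α : ℕ)
    (h : (Γ, M.code, α) ∈ L) :
    α ∈ interp ⟨ℕ, inferInstance, c, hc⟩ M fun x => {γ | (x, γ) ∈ Γ} := by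
  induction M generalizing Γ α with
  | var x =>
    have hx : (Term.var x).code % 3 = 0 ∧ (Term.var x).code / 3 = x := by
      simp only [Term.code]; omega
    obtain ⟨-, h'⟩ | ⟨h', -⟩ | ⟨h', -⟩ := hL _ h
    · rw [hx.2] at h'; exact h'
    · simp [hx.1] at h'
    · simp [hx.1] at h'
  | app M N ihM ihN =>
    obtain ⟨h3, hp⟩ := Term.code_app M N
    obtain ⟨h', -⟩ | ⟨-, e, he, h1, h2, h3⟩ | ⟨h', -⟩ := hL _ h
    · simp [h3] at h'
    · simp only [hp] at h1 h2 h3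
      refine ⟨e.1.toFinset, fun γ hγ => ihN _ _ (h3 γ (by simpa using hγ)), ?_⟩
      have := ihM _ _ h2
      rwa [← hA e he, h1] at this
    · simp [h3] at h'
  | lam x M ih =>
    obtain ⟨h3, hp⟩ := Term.code_lam x M
    obtain ⟨h', -⟩ | ⟨h', -⟩ | ⟨-, e, he, h1, k, hk, hk1, hk2, hk3⟩ := hL _ h
    · simp [h3] at h'
    · simp [h3] at h'
    · simp only [hp] at h1 hk1 hk3
      obtain ⟨Δ, n, β⟩ := k
      simp only at hk1 hk2 hk3
      subst hk1 hk2
      refine ⟨e.1.toFinset, e.2.1, ?_, h1.symm.trans (hA e he).symm⟩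
      refine interp_mono _ M (fun y => ?_) (ih _ _ hk)
      intro γ hγ
      obtain ⟨rfl, h5⟩ | ⟨h4, h5⟩ := hk3 _ hγ
      · simpa using h5
      · simpa [Function.update_of_ne h4] using h5

end GraphModel

/-- A finite partial injection extends to a total one, without further preimages of a given
number `m`. -/
theorem PartialInjection.exists_extension {A : List Equation} (hA : PartialInjection A) (m : ℕ) :
    ∃ c : Finset ℕ × ℕ → ℕ, Function.Injective c ∧
      (∀ e ∈ A, c (e.1.toFinset, e.2.1) = e.2.2) ∧
      ∀ p, c p = m → ∃ e ∈ A, e.2.2 = m ∧ p = (e.1.toFinset, e.2.1) := by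
  classical
  obtain ⟨B, hmB, hB⟩ : ∃ B, m < B ∧ ∀ e ∈ A, e.2.2 < B := by
    refine ⟨m + (A.map fun e => e.2.2).sum + 1, by omega, fun e he => ?_⟩
    have := List.le_sum_of_mem (List.mem_map_of_mem (f := fun e : Equation => e.2.2) he)
    omega
  -- pairs without an equation are mapped above `B`, away from `m` and from all values in `A`
  let P (p : Finset ℕ × ℕ) (e : Equation) : Prop := e ∈ A ∧ p = (e.1.toFinset, e.2.1)
  let c (p : Finset ℕ × ℕ) : ℕ :=
    if h : ∃ e, P p e then h.choose.2.2 else B + Encodable.encode p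
  have hpos {p : Finset ℕ × ℕ} (h : ∃ e, P p e) : ∃ e, P p e ∧ c p = e.2.2 :=
    ⟨h.choose, h.choose_spec, dif_pos h⟩
  have hneg {p : Finset ℕ × ℕ} (h : ¬ ∃ e, P p e) : c p = B + Encodable.encode p := dif_neg h
  refine ⟨c, fun p q hpq => ?_, fun e he => ?_, fun p hp => ?_⟩
  · by_cases h : ∃ e, P p e <;> by_cases h' : ∃ e, P q e
    · obtain ⟨e, ⟨he, rfl⟩, hce⟩ := hpos h
      obtain ⟨e', ⟨he', rfl⟩, hce'⟩ := hpos h'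
      obtain ⟨h1, h2⟩ := (hA e he e' he').1 (by rw [← hce, ← hce', hpq])
      rw [h1, h2]
    · obtain ⟨e, ⟨he, -⟩, hce⟩ := hpos h
      have := hB e he
      rw [hce, hneg h'] at hpq
      omega
    · obtain ⟨e, ⟨he, -⟩, hce⟩ := hpos h'
      have := hB e he
      rw [hce, hneg h] at hpq
      omega
    · rw [hneg h, hneg h'] at hpq
      exact Encodable.encode_injective (by omega)
  · obtain ⟨e', ⟨he', h⟩, hce⟩ := hpos ⟨e, he, rfl⟩
    rw [hce]
    exact (hA e' he' e he).2 ⟨(Prod.mk.inj h).1.symm, (Prod.mk.inj h).2.symm⟩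
  · by_cases h : ∃ e, P p e
    · obtain ⟨e, ⟨he, h⟩, hce⟩ := hpos h
      exact ⟨e, he, hce ▸ hp, h⟩
    · rw [hneg h] at hp
      omega

/-- Certificates are sound. -/
theorem Certificate.exists_not_subset {M : Term} {w : List Equation × List Judgment × Judgment}
    (h : Certificate M.code w) :
    ∃ (H : GraphModel.{0}) (ρ : ℕ → Set H.carrier), ¬ H.interp M ρ ⊆ H.interp idT ρ := by
  obtain ⟨A, L, Γ, n, α⟩ := w
  obtain ⟨hA, hL, hj, rfl, hα⟩ := h
  obtain ⟨c, hc, hcA, hcα⟩ := hA.exists_extension α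
  refine ⟨⟨ℕ, inferInstance, c, hc⟩, fun x => {γ | (x, γ) ∈ Γ}, fun hsub => ?_⟩
  obtain ⟨a, β, hβ, hc'⟩ :=
    hsub (GraphModel.mem_interp_of_justified c hc hcA hL M Γ α hj)
  obtain ⟨e, he, he', h⟩ := hcα _ hc'.symm
  obtain ⟨rfl, rfl⟩ := Prod.mk.inj h
  refine hα e he he' ?_
  have h2 : e.2.1 ∈ (e.1.toFinset : Set ℕ) := by
    simpa [GraphModel.interp] using hβ
  simpa using h2

theorem Justified.mono {A : List Equation} {L L' : List Judgment} (h : L ⊆ L') {j : Judgment}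
    (hj : Justified A L j) : Justified A L' j := by
  obtain hj | ⟨h0, e, he, h1, h2, h3⟩ | ⟨h0, e, he, h1, k, hk, h2⟩ := hj
  · exact .inl hj
  · exact .inr (.inl ⟨h0, e, he, h1, h h2, fun γ hγ => h (h3 γ hγ)⟩)
  · exact .inr (.inr ⟨h0, e, he, h1, k, h hk, h2⟩)

/-- The judgment `j` belongs to some set of judgments that is closed under justification. -/
def Derivable (A : List Equation) (j : Judgment) : Prop :=
  ∃ L : List Judgment, (∀ i ∈ L, Justified A L i) ∧ j ∈ L

theorem Derivable.of_justified {A : List Equation} {L : List Judgment}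
    (hL : ∀ i ∈ L, Derivable A i) {j : Judgment} (hj : Justified A L j) : Derivable A j := by
  obtain ⟨L', hL', hsub⟩ : ∃ L', (∀ i ∈ L', Justified A L' i) ∧ L ⊆ L' := by
    clear hj
    induction L with
    | nil => exact ⟨[], by simp, by simp⟩
    | cons i L ih =>
      obtain ⟨L₁, h₁, hs⟩ := ih fun k hk => hL k (List.mem_cons_of_mem _ hk)
      obtain ⟨L₂, h₂, hi⟩ := hL i List.mem_cons_self
      refine ⟨L₂ ++ L₁, fun k hk => ?_, List.cons_subset.2 ⟨by simp [hi], fun k hk => ?_⟩⟩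
      · obtain hk | hk := List.mem_append.1 hk
        · exact (h₂ k hk).mono (by simp)
        · exact (h₁ k hk).mono (by simp)
      · exact List.mem_append_right _ (hs hk)
  refine ⟨j :: L', fun i hi => ?_, List.mem_cons_self⟩
  obtain rfl | hi := List.mem_cons.1 hi
  · exact hj.mono fun _ h => List.mem_cons_of_mem _ (hsub h)
  · exact (hL' i hi).mono (List.subset_cons_self _ _)

namespace GraphModel

variable (G : GraphModel.{u})

open Classical in
/-- The equations that hold in `G` between elements of the finite set `S`, with elements named by
numbers through `e`. -/
noncomputable def equations (S : Finset G.carrier) (e : G.carrier → ℕ) : List Equation :=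
  ((S.powerset ×ˢ S).filter fun p => G.c p ∈ S).toList.map fun p =>
    (p.1.toList.map e, e p.2, e (G.c p))

open Classical in
/-- The environment `ρ`, restricted to the variables below `b` and to the finite set `S`, with
elements named by numbers through `e`. -/
noncomputable def finiteEnv (S : Finset G.carrier) (e : G.carrier → ℕ) (b : ℕ)
    (ρ : ℕ → Set G.carrier) : List (ℕ × ℕ) :=
  ((Finset.range b ×ˢ S).filter fun p => p.2 ∈ ρ p.1).toList.map fun p => (p.1, e p.2)

variable {G} {S : Finset G.carrier} {e : G.carrier → ℕ}

theorem mem_equations {q : Equation} : q ∈ G.equations S e ↔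
    ∃ (a : Finset G.carrier) (α : G.carrier), a ⊆ S ∧ α ∈ S ∧ G.c (a, α) ∈ S ∧
      q = (a.toList.map e, e α, e (G.c (a, α))) := by
  simp only [equations, List.mem_map, Finset.mem_toList, Finset.mem_filter, Finset.mem_product,
    Finset.mem_powerset, Prod.exists]
  grind

theorem mem_finiteEnv {b : ℕ} {ρ : ℕ → Set G.carrier} {q : ℕ × ℕ} : q ∈ G.finiteEnv S e b ρ ↔
    ∃ x γ, x < b ∧ γ ∈ S ∧ γ ∈ ρ x ∧ q = (x, e γ) := by
  simp only [finiteEnv, List.mem_map, Finset.mem_toList, Finset.mem_filter, Finset.mem_product,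
    Finset.mem_range, Prod.exists]
  grind

theorem partialInjection_equations (he : Set.InjOn e S) :
    PartialInjection (G.equations S e) := by
  classical
  rintro _ hp _ hq
  obtain ⟨a, α, ha, hα, hc, rfl⟩ := mem_equations.1 hp
  obtain ⟨b, β, hb, hβ, hd, rfl⟩ := mem_equations.1 hq
  have himage (d : Finset G.carrier) : (d.toList.map e).toFinset = d.image e := by
    ext; simp
  simp only [himage]
  constructor
  · intro h
    obtain ⟨rfl, rfl⟩ := Prod.mk.inj (G.injective (he hc hd h))
    exact ⟨rfl, rfl⟩
  · rintro ⟨h1, h2⟩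
    have hab : a = b := by
      apply Finset.coe_injective
      rw [← he.image_eq_image_iff (Finset.coe_subset.2 ha) (Finset.coe_subset.2 hb)]
      exact_mod_cast h1
    rw [hab, he hα hβ h2]

/-- The restricted interpretation is mirrored by derivable judgments. The bound `b` may be any number
above the code of the term, because the variables of a term are at most its code. -/
theorem derivable_of_mem_interpOn {b : ℕ} {M : Term} (hb : M.code < b)
    {ρ : ℕ → Set G.carrier} {α : G.carrier} (h : α ∈ G.interpOn S M ρ) :
    Derivable (G.equations S e) (G.finiteEnv S e b ρ, M.code, e α) := by
  induction M generalizing ρ α with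
  | var x =>
    have hx : (Term.var x).code % 3 = 0 ∧ (Term.var x).code / 3 = x := by
      simp only [Term.code]; omega
    refine .of_justified (L := []) (by simp) (.inl ⟨hx.1, ?_⟩)
    rw [hx.2]
    exact mem_finiteEnv.2 ⟨x, α, by simp only [Term.code] at hb; omega, h.2, h.1, rfl⟩
  | app M N ihM ihN =>
    obtain ⟨h3, hp⟩ := Term.code_app M N
    obtain ⟨hα, a, ha, hc⟩ := h
    have hM : M.code < b := by
      have := Nat.left_le_pair M.code N.code
      simp only [Term.code] at hb; omega
    have hN : N.code < b := by
      have := Nat.right_le_pair M.code N.code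
      simp only [Term.code] at hb; omega
    refine .of_justified (L := (G.finiteEnv S e b ρ, M.code, e (G.c (a, α))) ::
      a.toList.map fun γ => (G.finiteEnv S e b ρ, N.code, e γ)) ?_ (.inr (.inl ⟨h3, _,
        mem_equations.2 ⟨a, α, ?_, hα, G.interpOn_subset _ _ _ hc, rfl⟩, rfl, ?_, ?_⟩))
    · intro i hi
      obtain rfl | hi := List.mem_cons.1 hi
      · exact ihM hM hc
      · obtain ⟨γ, hγ, rfl⟩ := List.mem_map.1 hi
        exact ihN hN (ha (by simpa using hγ))
    · exact Finset.coe_subset.1 (ha.trans (G.interpOn_subset _ _ _))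
    · simp [hp]
    · intro γ hγ
      rw [hp]
      exact List.mem_cons_of_mem _ (List.mem_map.2 (by simpa using hγ))
  | lam x M ih =>
    obtain ⟨h3, hp⟩ := Term.code_lam x M
    obtain ⟨hβ, a, α, ha, hα, rfl⟩ := h
    have hM : M.code < b := by
      have := Nat.right_le_pair x M.code
      simp only [Term.code] at hb; omega
    refine .of_justified (L := [(G.finiteEnv S e b (Function.update ρ x a), M.code, e α)]) ?_
      (.inr (.inr ⟨h3, _, mem_equations.2 ⟨a, α, Finset.coe_subset.1 ha,
        G.interpOn_subset _ _ _ hα, hβ, rfl⟩, rfl, _, List.mem_singleton_self _, ?_, rfl, ?_⟩))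
    · simpa using ih hM hα
    · simp [hp]
    · intro q hq
      obtain ⟨y, γ, hy, hγ, hγ', rfl⟩ := mem_finiteEnv.1 hq
      simp only [hp]
      by_cases hxy : y = x
      · subst hxy
        have : γ ∈ a := by simpa using hγ'
        exact .inl ⟨rfl, by simpa using ⟨γ, this, rfl⟩⟩
      · rw [Function.update_of_ne hxy] at hγ'
        exact .inr ⟨hxy, mem_finiteEnv.2 ⟨y, γ, hy, hγ, hγ', rfl⟩⟩

/-- Certificates are complete. -/
theorem exists_certificate {M : Term} {ρ : ℕ → Set G.carrier}
    (h : ¬ G.interp M ρ ⊆ G.interp idT ρ) : ∃ w, Certificate M.code w := by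
  classical
  obtain ⟨α, hα, hI⟩ := Set.not_subset.1 h
  obtain ⟨S, hS⟩ := G.exists_finset_mem_interpOn hα
  let e (γ : G.carrier) : ℕ := S.toList.idxOf γ
  have he : Set.InjOn e S := fun γ hγ δ _ h =>
    (List.idxOf_inj (Finset.mem_toList.2 hγ)).1 h
  obtain ⟨L, hL, hj⟩ := derivable_of_mem_interpOn (e := e) (Nat.lt_succ_self _) hS
  refine ⟨(G.equations S e, L, _), partialInjection_equations he, hL, hj, rfl, ?_⟩
  intro q hq hqα
  obtain ⟨a, β, ha, hβ, hc, rfl⟩ := mem_equations.1 hq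
  have hcα : G.c (a, β) = α := he hc (G.interpOn_subset _ _ _ hS) hqα
  intro hmem
  obtain ⟨γ, hγ, hγβ⟩ := List.mem_map.1 hmem
  rw [Finset.mem_toList] at hγ
  obtain rfl := he (ha hγ) hβ hγβ
  exact hI ⟨a, γ, by simpa [interp] using hγ, hcα.symm⟩

end GraphModel
end LambdaGraph

/-! ### Representation of partial recursive functions -/

namespace LambdaGraph
open Term Turing.ToPartrec

/-- The Scott numeral of `n`: zero is `λxy.x` and the successor of `n` is `λxy.yn`. -/
def numT : ℕ → Term
  | 0 => lam 0 (lam 1 (var 0))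
  | n + 1 => lam 0 (lam 1 (app (var 1) (numT n)))

/-- The successor of Scott numerals. -/
def succT : Term := lam 2 (lam 0 (lam 1 (app (var 1) (var 2))))

/-- The pairing combinator `λxyz.zxy`. -/
def pairT : Term := lam 0 (lam 1 (lam 2 (app (app (var 2) (var 0)) (var 1))))

/-- The first projection from pairs. -/
def fstT : Term := lam 0 (app (var 0) (lam 0 (lam 1 (var 0))))

/-- The second projection from pairs. -/
def sndT : Term := lam 0 (app (var 0) (lam 0 (lam 1 (var 1))))

/-- The fixed point combinator `λf.(λx.f(xx))(λx.f(xx))`. -/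
def fixT : Term := lam 0 (app (lam 1 (app (var 0) (app (var 1) (var 1))))
  (lam 1 (app (var 0) (app (var 1) (var 1)))))

/-- The empty list, represented as the stream of zeros. -/
def nilT : Term := app fixT (app pairT (numT 0))

/-- The list `v`, represented as the stream of its entries followed by zeros. -/
def listT : List ℕ → Term
  | [] => nilT
  | n :: v => app (app pairT (numT n)) (listT v)

/-- The term that represents a partial recursive function on lists, given by a code.
Streams have a head and a tail throughout, which matches the conventions of `Code.eval` for the empty
list. In the last clause the variable `1` stands for the recursive call, and the abstraction of `2`
discards the predecessor that a positive numeral passes to its second argument. -/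
def codeT : Code → Term
  | .zero' => app pairT (numT 0)
  | .succ => lam 0 (app (app pairT (app succT (app fstT (var 0)))) nilT)
  | .tail => sndT
  | .cons f g => lam 0 (app (app pairT (app fstT (app (codeT f) (var 0)))) (app (codeT g) (var 0)))
  | .comp f g => lam 0 (app (codeT f) (app (codeT g) (var 0)))
  | .case f g => lam 0 (app (app (app fstT (var 0)) (app (codeT f) (app sndT (var 0))))
      (lam 1 (app (codeT g) (app (app pairT (var 1)) (app sndT (var 0))))))
  | .fix f => app fixT (lam 1 (lam 0 (app (app (app fstT (app (codeT f) (var 0)))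
      (app sndT (app (codeT f) (var 0)))) (lam 2 (app (var 1) (app sndT (app (codeT f) (var 0))))))))

namespace GraphModel

variable (G : GraphModel.{u})

@[simp] theorem interp_var (x : ℕ) (ρ : ℕ → Set G.carrier) : G.interp (var x) ρ = ρ x := rfl

@[simp] theorem interp_app (M N : Term) (ρ : ℕ → Set G.carrier) :
    G.interp (app M N) ρ = G.apply (G.interp M ρ) (G.interp N ρ) := rfl

theorem interp_lam (x : ℕ) (M : Term) (ρ : ℕ → Set G.carrier) :
    G.interp (lam x M) ρ = G.abstr fun d => G.interp M (Function.update ρ x d) := rfl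

/-- The value of a closed term, read off in the empty environment. -/
def val (M : Term) : Set G.carrier := G.interp M fun _ => ∅

@[simp] theorem val_app (M N : Term) : G.val (app M N) = G.apply (G.val M) (G.val N) := rfl

theorem val_lam (x : ℕ) (M : Term) : G.val (lam x M) = G.interp (lam x M) fun _ => ∅ := rfl

@[simp] theorem interp_numT (n : ℕ) (ρ : ℕ → Set G.carrier) :
    G.interp (numT n) ρ = G.val (numT n) := by
  induction n generalizing ρ with
  | zero => simp [numT, val_lam, interp_lam]
  | succ n ih => simp [numT, val_lam, interp_lam, ih (Function.update _ _ _)]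

theorem interp_pairT (ρ : ℕ → Set G.carrier) : G.interp pairT ρ = G.val pairT := by
  simp [pairT, val_lam, interp_lam]

theorem interp_fixT (ρ : ℕ → Set G.carrier) : G.interp fixT ρ = G.val fixT := by
  simp [fixT, val_lam, interp_lam]

@[simp] theorem interp_listT (v : List ℕ) (ρ : ℕ → Set G.carrier) :
    G.interp (listT v) ρ = G.val (listT v) := by
  induction v with
  | nil => simp [listT, nilT, interp_pairT _ ρ, interp_fixT _ ρ]
  | cons n v ih => simp [listT, ih, interp_pairT _ ρ]

@[simp] theorem interp_nilT (ρ : ℕ → Set G.carrier) : G.interp nilT ρ = G.val (listT []) :=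
  G.interp_listT [] ρ

variable (ρ : ℕ → Set G.carrier) (X Y Z : Set G.carrier)

@[simp] theorem apply_numT_zero : G.apply (G.apply (G.val (numT 0)) X) Y = X := by
  simp [numT, val_lam, apply_interp_lam]

@[simp] theorem apply_numT_succ (n : ℕ) :
    G.apply (G.apply (G.val (numT (n + 1))) X) Y = G.apply Y (G.val (numT n)) := by
  simp [numT, val_lam, apply_interp_lam]

@[simp] theorem apply_succT (n : ℕ) :
    G.apply (G.interp succT ρ) (G.val (numT n)) = G.val (numT (n + 1)) := by
  simp [succT, apply_interp_lam]
  simp [numT, val_lam, interp_lam]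

@[simp] theorem apply_fstT_pairT : G.apply (G.interp fstT ρ)
    (G.apply (G.apply (G.val pairT) X) Y) = X := by
  simp [fstT, pairT, val_lam, apply_interp_lam]

@[simp] theorem apply_sndT_pairT : G.apply (G.interp sndT ρ)
    (G.apply (G.apply (G.val pairT) X) Y) = Y := by
  simp [sndT, pairT, val_lam, apply_interp_lam]

theorem apply_fixT :
    G.apply (G.interp fixT ρ) X = G.apply X (G.apply (G.interp fixT ρ) X) := by
  have h : G.apply (G.interp fixT ρ) X = G.apply
      (G.interp (lam 1 (app (var 0) (app (var 1) (var 1)))) (Function.update ρ 0 X))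
      (G.interp (lam 1 (app (var 0) (app (var 1) (var 1)))) (Function.update ρ 0 X)) := by
    rw [fixT, apply_interp_lam, interp_app]
  rw [h]
  conv_lhs => rw [apply_interp_lam]
  simp

theorem val_listT_cons (n : ℕ) (v : List ℕ) : G.val (listT (n :: v)) =
    G.apply (G.apply (G.val pairT) (G.val (numT n))) (G.val (listT v)) := rfl

theorem val_listT_nil : G.val (listT []) =
    G.apply (G.apply (G.val pairT) (G.val (numT 0))) (G.val (listT [])) := by
  exact G.apply_fixT _ _

@[simp] theorem apply_fstT_listT (v : List ℕ) :
    G.apply (G.interp fstT ρ) (G.val (listT v)) = G.val (numT v.headI) := by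
  cases v with
  | nil => rw [val_listT_nil, apply_fstT_pairT]; rfl
  | cons n v => rw [val_listT_cons, apply_fstT_pairT]; rfl

@[simp] theorem apply_sndT_listT (v : List ℕ) :
    G.apply (G.interp sndT ρ) (G.val (listT v)) = G.val (listT v.tail) := by
  cases v with
  | nil => rw [val_listT_nil, apply_sndT_pairT]; rfl
  | cons n v => rw [val_listT_cons, apply_sndT_pairT]; rfl

/-- The terms `codeT c` compute: where the function with code `c` is defined, the term takes
the representation of the argument to that of the value. -/
theorem apply_codeT (c : Code) {v w : List ℕ} (h : w ∈ c.eval v) :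
    G.apply (G.interp (codeT c) ρ) (G.val (listT v)) = G.val (listT w) := by
  induction c generalizing v w ρ with
  | zero' =>
    obtain rfl : w = 0 :: v := by simpa using h
    simp [codeT, val_listT_cons, interp_pairT _ ρ]
  | succ =>
    obtain rfl : w = [v.headI.succ] := by simpa using h
    simp [codeT, apply_interp_lam, val_listT_cons, interp_pairT _ (Function.update _ _ _)]
  | tail =>
    obtain rfl : w = v.tail := by simpa using h
    simp [codeT]
  | cons f g ihf ihg =>
    simp only [Code.cons_eval, Part.bind_eq_bind, Part.mem_bind_iff, Part.pure_eq_some,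
      Part.mem_some_iff] at h
    obtain ⟨u, hu, u', hu', rfl⟩ := h
    simp [codeT, apply_interp_lam, val_listT_cons, interp_pairT _ (Function.update _ _ _),
      ihf _ hu, ihg _ hu']
  | comp f g ihf ihg =>
    rw [Code.comp_eval] at h
    obtain ⟨u, hu, hw⟩ := Part.mem_bind_iff.1 h
    simp [codeT, apply_interp_lam, ihg _ hu, ihf _ hw]
  | case f g ihf ihg =>
    simp only [Code.case_eval] at h
    simp only [codeT, apply_interp_lam, interp_app, interp_var, Function.update_self,
      apply_fstT_listT, apply_sndT_listT]
    cases hv : v.headI with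
    | zero =>
      rw [hv] at h
      simp [ihf _ h]
    | succ n =>
      rw [hv] at h
      simp [apply_interp_lam, interp_pairT _ (Function.update _ _ _), ← val_listT_cons, ihg _ h]
  | fix f ih =>
    rw [Code.fix_eval] at h
    refine PFun.fixInduction' h (fun u hu => ?_) fun u u' _ hu hu' => ?_
    all_goals
      obtain ⟨t, ht, hut⟩ := (Part.mem_map_iff _).1 hu
      rw [codeT, interp_app, apply_fixT]
      conv_lhs => rw [apply_interp_lam, apply_interp_lam]
      simp only [interp_app, interp_var, Function.update_self, ih _ ht, apply_fstT_listT,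
        apply_sndT_listT]
      split_ifs at hut with h0
    · rw [h0, apply_numT_zero, Sum.inl.inj hut]
    · obtain ⟨n, hn⟩ := Nat.exists_eq_succ_of_ne_zero h0
      rw [hn, Nat.succ_eq_add_one, apply_numT_succ, apply_interp_lam]
      simp [ih _ ht, Sum.inr.inj hut]
      exact hu'

end GraphModel
end LambdaGraph

/-! ### Certificates are primitive recursive -/

namespace LambdaGraph
open Primrec

section Primrec

variable {α β : Type*} [Primcodable α] [Primcodable β]

theorem primrecPred_exists_mem {l : α → List β} (hl : Primrec l) {R : α → β → Prop}
    (hR : PrimrecPred fun p : α × β => R p.1 p.2) : PrimrecPred fun x => ∃ y ∈ l x, R x y :=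
  (PrimrecRel.exists_mem_list (R := fun y x => R x y) (hR.comp (snd.pair fst))).comp hl .id

theorem primrecPred_forall_mem {l : α → List β} (hl : Primrec l) {R : α → β → Prop}
    (hR : PrimrecPred fun p : α × β => R p.1 p.2) : PrimrecPred fun x => ∀ y ∈ l x, R x y :=
  (PrimrecRel.forall_mem_list (R := fun y x => R x y) (hR.comp (snd.pair fst))).comp hl .id

theorem primrecPred_mem {f : α → β} {l : α → List β} (hf : Primrec f) (hl : Primrec l) :
    PrimrecPred fun x => f x ∈ l x :=
  (primrecPred_exists_mem hl (R := fun x y => y = f x)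
    (Primrec.eq.comp snd (hf.comp fst))).of_eq fun x => by simp

/-- The projection of a primitive recursive relation is recursively enumerable. -/
theorem rePred_exists {R : α → β → Prop} (hR : PrimrecPred fun p : α × β => R p.1 p.2) :
    REPred fun x => ∃ y, R x y := by
  classical
  -- search through the codes of elements of `β`
  let P (x : α) (n : ℕ) : Bool := ((Encodable.decode n : Option β).map fun y =>
    decide (R x y)).getD false
  have hP : Computable₂ P := by
    refine Primrec.to_comp ?_
    exact option_getD.comp
      (option_map (Primrec.decode.comp snd)
        (hR.decide.comp ((fst.comp fst).pair snd)).to₂) (const false)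
  refine (Partrec.rfind hP.partrec₂).dom_re.of_eq fun x => ?_
  constructor
  · intro h
    obtain ⟨n, hn, -⟩ := Nat.rfind_dom.1 h
    cases hd : (Encodable.decode n : Option β) with
    | none => simp [P, hd] at hn
    | some y => exact ⟨y, by simpa [P, hd] using hn⟩
  · rintro ⟨y, hy⟩
    exact Nat.rfind_dom.2 ⟨Encodable.encode y, by simp [P, hy], fun _ => trivial⟩

end Primrec

theorem primrec_partialInjection : PrimrecPred PartialInjection := by
  have ha : Primrec fun p : (List Equation × Equation) × Equation => p.1.2.1 :=
    fst.comp (snd.comp fst)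
  have hb : Primrec fun p : (List Equation × Equation) × Equation => p.2.1 := fst.comp snd
  have hα : PrimrecPred fun p : (List Equation × Equation) × Equation => p.1.2.2.1 = p.2.2.1 :=
    Primrec.eq.comp (fst.comp (snd.comp (snd.comp fst))) (fst.comp (snd.comp snd))
  have hβ : PrimrecPred fun p : (List Equation × Equation) × Equation => p.1.2.2.2 = p.2.2.2 :=
    Primrec.eq.comp (snd.comp (snd.comp (snd.comp fst))) (snd.comp (snd.comp snd))
  have hab : PrimrecPred fun p : (List Equation × Equation) × Equation =>
      p.1.2.1.toFinset = p.2.1.toFinset :=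
    ((primrecPred_forall_mem ha (R := fun p x => x ∈ p.2.1)
      (primrecPred_mem snd (hb.comp fst))).and
      (primrecPred_forall_mem hb (R := fun p x => x ∈ p.1.2.1)
      (primrecPred_mem snd (ha.comp fst)))).of_eq fun p => by
        simp only [Finset.ext_iff, List.mem_toFinset, iff_iff_implies_and_implies, forall_and]
  have h : PrimrecPred fun p : (List Equation × Equation) × Equation =>
      p.1.2.2.2 = p.2.2.2 ↔ p.1.2.1.toFinset = p.2.1.toFinset ∧ p.1.2.2.1 = p.2.2.1 :=
    ((hβ.and (hab.and hα)).or (hβ.not.and (hab.and hα).not)).of_eq fun p => by tauto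
  exact primrecPred_forall_mem .id (primrecPred_forall_mem fst
    (R := fun (p : List Equation × Equation) (e' : Equation) =>
      p.2.2.2 = e'.2.2 ↔ p.2.1.toFinset = e'.1.toFinset ∧ p.2.2.1 = e'.2.1) h)

theorem primrec_justified : PrimrecPred fun p : List Equation × List Judgment × Judgment =>
    Justified p.1 p.2.1 p.2.2 := by
  let X := List Equation × List Judgment × Judgment
  have hL : Primrec fun p : X => p.2.1 := fst.comp snd
  have hΓ : Primrec fun p : X => p.2.2.1 := fst.comp (snd.comp snd)
  have hn : Primrec fun p : X => p.2.2.2.1 := fst.comp (snd.comp (snd.comp snd))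
  have hα : Primrec fun p : X => p.2.2.2.2 := snd.comp (snd.comp (snd.comp snd))
  have hmod (r : ℕ) : PrimrecPred fun p : X => p.2.2.2.1 % 3 = r :=
    Primrec.eq.comp (nat_mod.comp hn (const 3)) (const r)
  have hdiv : Primrec fun p : X => p.2.2.2.1 / 3 := nat_div.comp hn (const 3)
  have hl : Primrec fun p : X => (p.2.2.2.1 / 3).unpair.1 := fst.comp (unpair.comp hdiv)
  have hr : Primrec fun p : X => (p.2.2.2.1 / 3).unpair.2 := snd.comp (unpair.comp hdiv)
  refine ((hmod 0).and ?_).or (((hmod 1).and ?_).or ((hmod 2).and ?_))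
  · exact primrecPred_mem (hdiv.pair hα) hΓ
  · refine primrecPred_exists_mem fst (R := fun (p : X) (e : Equation) => e.2.1 = p.2.2.2.2 ∧
      (p.2.2.1, (p.2.2.2.1 / 3).unpair.1, e.2.2) ∈ p.2.1 ∧
      ∀ γ ∈ e.1, (p.2.2.1, (p.2.2.2.1 / 3).unpair.2, γ) ∈ p.2.1)
      (.and ?_ (.and ?_ ?_))
    · exact Primrec.eq.comp (fst.comp (snd.comp snd)) (hα.comp fst)
    · exact primrecPred_mem ((hΓ.comp fst).pair ((hl.comp fst).pair (snd.comp (snd.comp snd))))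
        (hL.comp fst)
    · exact primrecPred_forall_mem (fst.comp snd)
        (R := fun (q : X × Equation) (γ : ℕ) =>
          (q.1.2.2.1, (q.1.2.2.2.1 / 3).unpair.2, γ) ∈ q.1.2.1)
        (primrecPred_mem ((hΓ.comp (fst.comp fst)).pair ((hr.comp (fst.comp fst)).pair snd))
          (hL.comp (fst.comp fst)))
  · refine primrecPred_exists_mem fst (R := fun (p : X) (e : Equation) =>
      e.2.2 = p.2.2.2.2 ∧ ∃ k ∈ p.2.1,
      k.2.1 = (p.2.2.2.1 / 3).unpair.2 ∧ k.2.2 = e.2.1 ∧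
      ∀ b ∈ k.1, (b.1 = (p.2.2.2.1 / 3).unpair.1 ∧ b.2 ∈ e.1) ∨
        (b.1 ≠ (p.2.2.2.1 / 3).unpair.1 ∧ b ∈ p.2.2.1))
      (.and ?_ ?_)
    · exact Primrec.eq.comp (snd.comp (snd.comp snd)) (hα.comp fst)
    refine primrecPred_exists_mem (hL.comp fst) (R := fun (q : X × Equation) (k : Judgment) =>
      k.2.1 = (q.1.2.2.2.1 / 3).unpair.2 ∧ k.2.2 = q.2.2.1 ∧
      ∀ b ∈ k.1, (b.1 = (q.1.2.2.2.1 / 3).unpair.1 ∧ b.2 ∈ q.2.1) ∨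
        (b.1 ≠ (q.1.2.2.2.1 / 3).unpair.1 ∧ b ∈ q.1.2.2.1)) (.and ?_ (.and ?_ ?_))
    · exact Primrec.eq.comp (fst.comp (snd.comp snd)) (hr.comp (fst.comp fst))
    · exact Primrec.eq.comp (snd.comp (snd.comp snd)) (fst.comp (snd.comp (snd.comp fst)))
    refine primrecPred_forall_mem (fst.comp snd)
      (R := fun (t : (X × Equation) × Judgment) (b : ℕ × ℕ) =>
        (b.1 = (t.1.1.2.2.2.1 / 3).unpair.1 ∧ b.2 ∈ t.1.2.1) ∨
        (b.1 ≠ (t.1.1.2.2.2.1 / 3).unpair.1 ∧ b ∈ t.1.1.2.2.1)) ?_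
    have hx : PrimrecPred fun s : ((X × Equation) × Judgment) × ℕ × ℕ =>
        s.2.1 = (s.1.1.1.2.2.2.1 / 3).unpair.1 :=
      Primrec.eq.comp (fst.comp snd) (hl.comp (fst.comp (fst.comp fst)))
    refine (hx.and ?_).or (hx.not.and ?_)
    · exact primrecPred_mem (snd.comp snd) (fst.comp (snd.comp (fst.comp fst)))
    · exact primrecPred_mem snd (hΓ.comp (fst.comp (fst.comp fst)))

theorem rePred_exists_certificate : REPred fun n : ℕ => ∃ w, Certificate n w := by
  let W := List Equation × List Judgment × Judgment
  have hA : Primrec fun p : ℕ × W => p.2.1 := fst.comp snd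
  have hL : Primrec fun p : ℕ × W => p.2.2.1 := fst.comp (snd.comp snd)
  have hj : Primrec fun p : ℕ × W => p.2.2.2 := snd.comp (snd.comp snd)
  refine rePred_exists (.and (primrec_partialInjection.comp hA) (.and ?_ (.and ?_ (.and ?_ ?_))))
  · exact primrecPred_forall_mem hL (R := fun (p : ℕ × W) (j : Judgment) => Justified p.2.1 p.2.2.1 j)
      (primrec_justified.comp ((hA.comp fst).pair ((hL.comp fst).pair snd)))
  · exact primrecPred_mem hj hL
  · exact Primrec.eq.comp (fst.comp (snd.comp hj)) fst
  · refine primrecPred_forall_mem hA (R := fun (p : ℕ × W) (e : Equation) =>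
      e.2.2 = p.2.2.2.2.2 → e.2.1 ∉ e.1) ?_
    have h1 : PrimrecPred fun q : (ℕ × W) × Equation => q.2.2.2 = q.1.2.2.2.2.2 :=
      Primrec.eq.comp (snd.comp (snd.comp snd)) (snd.comp (snd.comp (hj.comp fst)))
    have h2 : PrimrecPred fun q : (ℕ × W) × Equation => q.2.2.1 ∈ q.2.1 :=
      primrecPred_mem (fst.comp (snd.comp snd)) (fst.comp snd)
    exact (h1.not.or h2.not).of_eq fun q => by tauto

end LambdaGraph

/-! ### Diagonalization -/

namespace LambdaGraph
open Term

/-- The combinator `λxy.x`. -/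
def constT : Term := lam 0 (lam 1 (var 0))

theorem primrec_code_numT : Primrec fun n => (numT n).code := by
  refine (Primrec.nat_rec₁ (numT 0).code
    (f := fun _ m => 3 * Nat.pair 0 (3 * Nat.pair 1 (3 * Nat.pair 3 m + 1) + 2) + 2) ?_).of_eq
    fun n => ?_
  · have hmul {f : ℕ × ℕ → ℕ} (hf : Primrec f) (k r : ℕ) :
        Primrec fun p => 3 * Nat.pair k (f p) + r :=
      Primrec.nat_add.comp (Primrec.nat_mul.comp (.const 3)
        (Primrec₂.natPair.comp (.const k) hf)) (.const r)
    exact hmul (hmul (hmul Primrec.snd 3 1) 1 2) 0 2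
  · induction n with
    | zero => rfl
    | succ n ih => simp only [ih]; rfl

open Turing.ToPartrec in
theorem exists_code_of_partrec {f : ℕ →. ℕ} (hf : Partrec f) :
    ∃ c : Code, ∀ n, ∀ m ∈ f n, [m] ∈ c.eval [n] := by
  obtain ⟨c, hc⟩ := Code.exists_code (Nat.Partrec'.part_iff₁.2 hf)
  refine ⟨c, fun n m hm => ?_⟩
  have h := hc ⟨[n], rfl⟩
  simp only at h
  rw [h]
  exact (Part.mem_map_iff _).2 ⟨m, hm, rfl⟩

/-- The term that, on the Scott numeral of `n`, decides by the value of the function with code `c`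
at `n` between `λxy.x` (value zero) and `λx.x` (positive value). -/
def switchT (c : Turing.ToPartrec.Code) : Term :=
  lam 0 (app (app (app fstT (app (codeT c) (app (app pairT (var 0)) nilT))) constT) (lam 1 idT))

namespace GraphModel

variable (G : GraphModel.{u}) (ρ : ℕ → Set G.carrier)

theorem interp_constT (σ : ℕ → Set G.carrier) : G.interp constT σ = G.interp constT ρ := by
  simp [constT, interp_lam]

theorem interp_idT (σ : ℕ → Set G.carrier) : G.interp idT σ = G.interp idT ρ := by
  simp [idT, interp_lam]

theorem apply_switchT {c : Turing.ToPartrec.Code} {n m : ℕ} (h : [m] ∈ c.eval [n]) :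
    G.interp (app (switchT c) (numT n)) ρ =
      G.apply (G.apply (G.val (numT m)) (G.interp constT ρ)) (G.interp (lam 1 idT) ρ) := by
  have h' := G.apply_codeT (Function.update ρ 0 (G.val (numT n))) c h
  rw [G.val_listT_cons n] at h'
  rw [interp_app, switchT, apply_interp_lam]
  simp [G.interp_pairT (Function.update _ _ _), h', G.interp_constT ρ (Function.update _ _ _),
    G.interp_idT ρ (Function.update _ _ _), interp_lam]

end GraphModel

/-- A self-referential conditional: for every partial recursive `f` there is a term `F` which, in
all graph models, equals `λxy.x` or `λx.x` according to whether `f` at the code of `F` is zero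
or one. The two clauses speak of graph models in independent universes. -/
theorem exists_diagonal {f : ℕ →. ℕ} (hf : Partrec f) : ∃ F : Term,
    (0 ∈ f F.code → ∀ (H : GraphModel.{u}) ρ, H.interp F ρ = H.interp constT ρ) ∧
    (1 ∈ f F.code → ∀ (H : GraphModel.{v}) ρ, H.interp F ρ = H.interp idT ρ) := by
  -- `s n` is the code of `M` applied to the numeral of its own code, where `n` is the code of `M`
  let s (n : ℕ) : ℕ := 3 * Nat.pair n (numT n).code + 1
  have hs : Primrec s := Primrec.nat_add.comp (Primrec.nat_mul.comp (.const 3)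
    (Primrec₂.natPair.comp .id primrec_code_numT)) (.const 1)
  obtain ⟨c, hc⟩ := exists_code_of_partrec (hf.comp hs.to_comp)
  refine ⟨app (switchT c) (numT (switchT c).code), fun h H ρ => ?_, fun h H ρ => ?_⟩
  · rw [H.apply_switchT ρ (hc _ _ h), GraphModel.apply_numT_zero]
  · rw [H.apply_switchT ρ (hc _ _ h), GraphModel.apply_numT_succ, GraphModel.apply_interp_lam,
      H.interp_idT ρ]

namespace GraphModel

theorem not_interp_constT_subset (G : GraphModel.{u}) (ρ : ℕ → Set G.carrier) :
    ¬ G.interp constT ρ ⊆ G.interp idT ρ := by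
  intro h
  obtain ⟨γ⟩ : Nonempty G.carrier := G.infinite.nonempty
  -- `c({γ}, c(b, γ))` is in `λxy.x` for all `b`, and in `λx.x` only if `c(b, γ) = γ`
  have key (b : Finset G.carrier) : G.c (b, γ) = γ := by
    obtain ⟨a, α, hα, hc⟩ := h (show G.c ({γ}, G.c (b, γ)) ∈ G.interp constT ρ from
      ⟨{γ}, _, ⟨b, γ, by simp, rfl⟩, rfl⟩)
    obtain ⟨rfl, rfl⟩ := Prod.mk.inj (G.injective hc)
    simpa using hα
  have := G.injective ((key ∅).trans (key {γ}).symm)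
  simp at this

end GraphModel
theorem rePred_mem_ord (G : GraphModel.{u}) (hG : IsRE G.Ord) (N : Term) :
    REPred fun n : ℕ => ∃ M : Term, M.code = n ∧ ∀ ρ, G.interp M ρ ⊆ G.interp N ρ := by
  have hpair : Computable fun n : ℕ => Nat.pair n N.code :=
    (Primrec₂.natPair.comp .id (.const _)).to_comp
  refine REPred.of_eq (p := fun n : ℕ => ∃ p ∈ G.Ord, Nat.pair n N.code =
    Nat.pair p.1.code p.2.code) (Partrec.comp hG hpair) fun n => ?_
  constructor
  · rintro ⟨⟨M, N'⟩, h, hn⟩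
    obtain ⟨rfl, hN⟩ := Nat.pair_eq_pair.1 hn
    obtain rfl := code_bijective.1 hN
    exact ⟨M, rfl, h⟩
  · rintro ⟨M, rfl, h⟩
    exact ⟨(M, N), h, rfl⟩

/-- Two recursively enumerable sets that cover the natural numbers can be shrunk to a recursive
partition. -/
theorem exists_partrec_of_cover {p q : ℕ → Prop} (hp : REPred p) (hq : REPred q)
    (h : ∀ n, p n ∨ q n) :
    ∃ f : ℕ →. ℕ, Partrec f ∧ ∀ n, (0 ∈ f n ∧ p n) ∨ (1 ∈ f n ∧ q n) := by
  obtain ⟨f, hf, hfpq⟩ := Partrec.merge' (hp.map (Computable.const 0).to₂)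
    (hq.map (Computable.const 1).to₂)
  refine ⟨f, hf, fun n => ?_⟩
  have hdom : (f n).Dom := (hfpq n).2.2 ((h n).imp (⟨·, trivial⟩) (⟨·, trivial⟩))
  obtain ⟨m, hm⟩ := Part.dom_iff_mem.1 hdom
  obtain h' | h' := (hfpq n).1 m hm
  · obtain ⟨hpn, rfl⟩ : p n ∧ 0 = m := by simpa using h'
    exact .inl ⟨hm, hpn⟩
  · obtain ⟨hqn, rfl⟩ : q n ∧ 1 = m := by simpa using h'
    exact .inr ⟨hm, hqn⟩

end LambdaGraph

open LambdaGraph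

theorem mainTheorem2 (G : LambdaGraph.GraphModel.{u}) : ¬ LambdaGraph.IsRE G.Ord := by
  intro hG
  have hcover (n : ℕ) : (∃ M : Term, M.code = n ∧ ∀ ρ, G.interp M ρ ⊆ G.interp idT ρ) ∨
      ∃ w, Certificate n w := by
    obtain ⟨M, rfl⟩ := Term.code_bijective.2 n
    by_cases h : ∀ ρ, G.interp M ρ ⊆ G.interp idT ρ
    · exact .inl ⟨M, rfl, h⟩
    · obtain ⟨ρ, hρ⟩ := not_forall.1 h
      exact .inr (GraphModel.exists_certificate hρ)
  obtain ⟨f, hf, hfpq⟩ :=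
    exists_partrec_of_cover (rePred_mem_ord G hG idT) rePred_exists_certificate hcover
  obtain ⟨F, hF0, hF1⟩ := exists_diagonal.{u, 0} hf
  obtain ⟨h0, M, hM, hle⟩ | ⟨h1, w, hw⟩ := hfpq F.code
  · obtain rfl := Term.code_bijective.1 hM
    have h := hle fun _ => ∅
    rw [hF0 h0] at h
    exact G.not_interp_constT_subset _ h
  · obtain ⟨H, ρ, hH⟩ := hw.exists_not_subset
    exact hH (hF1 h1 H ρ).subset
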